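/- Let $m\ge 3$ and $\ell\ge 1$ be integers, and let $F:\mathrm{GF}(2^{2m})\to\mathrm{GF}(2^{\ell})$ be a bent vectorial function, that is, for every $\lambda\in\mathrm{GF}(2^\ell)\setminus\{0\}$ and every $\mu\in\mathrm{GF}(2^{2m})$, $$\sum_{x\in \mathrm{GF}(2^{2m})}(-1)^{\mathrm{Tr}_{2^\ell/2}(\lambda F(x))+\mathrm{Tr}_{2^{2m}/2}(\mu x)}\in\{2^m,-2^m\},$$ where $\mathrm{Tr}_{2^n/2}$ denotes the absolute trace from $\mathrm{GF}(2^n)$ to $\mathrm{GF}(2)$. Let $\mathcal C(F)$ be the binary linear code of length $2^{2m}$, with coordinate positions indexed by the elements of $\mathrm{GF}(2^{2m})$, $$\mathcal C(F)=\left\{\left(\mathrm{Tr}_{2^\ell/2}(aF(x))+\mathrm{Tr}_{2^{2m}/2}(bx)+c\right)_{x\in\mathrm{GF}(2^{2m})} : a\in\mathrm{GF}(2^\ell),\ b\in\mathrm{GF}(2^{2m}),\ c\in\mathrm{GF}(2)\right\}.$$ Let $t_1$ be any coordinate position, and let $\mathcal C(F)_{\{t_1\}}$ be the shortened code, obtained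 by taking all codewords of $\mathcal C(F)$ that are $0$ at position $t_1$ and deleting that position. Then $\mathcal C(F)_{\{t_1\}}$ is a binary linear code of length $2^{2m}-1$ and dimension $2m+\ell$, and its weight distribution is as follows: the number of codewords of Hamming weight - $0$ is $1$; - $2^{2m-1}-2^{m-1}$ is $(2^{\ell}-1)(2^{2m-1}+2^{m-1})$; - $2^{2m-1}$ is $2^{2m}-1$; - $2^{2m-1}+2^{m-1}$ is $(2^{\ell}-1)(2^{2m-1}-2^{m-1})$; and there are no codewords of any other weight. -/

import Mathlib

/-! Linear codes are submodules of `ι → k`, the coordinate positions being the elements of `ι`. -/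

/-- The length of a linear code: its number of coordinate positions. -/
def codeLength {k ι : Type*} [Field k] [Fintype ι] (_C : Submodule k (ι → k)) : ℕ :=
  Fintype.card ι

/-- `weightCount C w` is the number `A_w(C)` of codewords of Hamming weight `w` in `C`. -/
noncomputable def weightCount {k ι : Type*} [Field k] [DecidableEq k] [Fintype ι]
    (C : Submodule k (ι → k)) (w : ℕ) : ℕ :=
  {c : ι → k | c ∈ C ∧ hammingNorm c = w}.ncard

/-- The subcode `C(T)` of the codewords that vanish on the set `T` of positions. -/
def vanishingSubcode {k ι : Type*} [Field k] (C : Submodule k (ι → k)) (T : Finset ι) :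
    Submodule k (ι → k) where
  carrier := {c | c ∈ C ∧ ∀ i ∈ T, c i = 0}
  zero_mem' := ⟨C.zero_mem, fun _ _ => rfl⟩
  add_mem' := fun {c d} hc hd =>
    ⟨C.add_mem hc.1 hd.1, fun i hi => by simp [hc.2 i hi, hd.2 i hi]⟩
  smul_mem' := fun r c hc => ⟨C.smul_mem r hc.1, fun i hi => by simp [hc.2 i hi]⟩

/-- Puncturing `C` on `T`: delete the coordinates in `T` from every codeword. -/
def puncturedCode {k ι : Type*} [Field k] (C : Submodule k (ι → k)) (T : Finset ι) :
    Submodule k ({i : ι // i ∉ T} → k) :=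
  C.map (LinearMap.funLeft k k (Subtype.val : {i : ι // i ∉ T} → ι))

/-- The shortened code `C_T`: the subcode `C(T)`, punctured on `T`. -/
def shortenedCode {k ι : Type*} [Field k] (C : Submodule k (ι → k)) (T : Finset ι) :
    Submodule k ({i : ι // i ∉ T} → k) :=
  puncturedCode (vanishingSubcode C T) T

/-- The Walsh coefficient `∑ x, (-1) ^ (Tr (lam * F x) + Tr (mu * x))` of `F : E → K`, for finite
fields `E`, `K` of characteristic two with their absolute traces. -/
noncomputable def walsh {E K : Type*} [Field E] [Fintype E] [Algebra (ZMod 2) E]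
    [Field K] [Algebra (ZMod 2) K] (F : E → K) (lam : K) (mu : E) : ℤ :=
  ∑ x : E, (-1 : ℤ) ^ (Algebra.trace (ZMod 2) K (lam * F x) +
    Algebra.trace (ZMod 2) E (mu * x)).val

/-- A function `F : E → K`, where `E` has `2 ^ (2 * m)` elements, is bent vectorial if all its
nonzero component functions `x ↦ Tr (lam * F x)` are bent, that is, all their Walsh coefficients
are `2 ^ m` or `-2 ^ m`. -/
def IsBentVectorial {E K : Type*} [Field E] [Fintype E] [Algebra (ZMod 2) E]
    [Field K] [Algebra (ZMod 2) K] (m : ℕ) (F : E → K) : Prop :=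
  ∀ lam : K, lam ≠ 0 → ∀ mu : E, walsh F lam mu = 2 ^ m ∨ walsh F lam mu = -2 ^ m

/-- The binary code `C(F)` of the words `(Tr (a * F x) + Tr (b * x) + c)_{x ∈ E}` with `a ∈ K`,
`b ∈ E` and `c ∈ GF(2)`. -/
def vectorialCode {E K : Type*} [Field E] [Algebra (ZMod 2) E]
    [Field K] [Algebra (ZMod 2) K] (F : E → K) : Submodule (ZMod 2) (E → ZMod 2) where
  carrier := {w | ∃ (a : K) (b : E) (c : ZMod 2), ∀ x,
    w x = Algebra.trace (ZMod 2) K (a * F x) + Algebra.trace (ZMod 2) E (b * x) + c}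
  zero_mem' := ⟨0, 0, 0, fun x => by simp⟩
  add_mem' := by
    rintro w w' ⟨a, b, c, h⟩ ⟨a', b', c', h'⟩
    refine ⟨a + a', b + b', c + c', fun x => ?_⟩
    simp only [Pi.add_apply, h, h', add_mul, map_add]
    ring
  smul_mem' := by
    rintro r w ⟨a, b, c, h⟩
    refine ⟨r • a, r • b, r * c, fun x => ?_⟩
    simp only [Pi.smul_apply, h, smul_mul_assoc, map_smul, smul_eq_mul]
    ring

/-! A codeword vanishing at `t` is determined by `(a, b)`, the constant `c` being forced, so the
shortened code is the image of `K × E` under `basedWord`. The weight of a word is read off its sign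
sum (`sum_binarySign`), here a Walsh coefficient up to sign: `±2 ^ m` if `a ≠ 0`, and `0` if `a = 0`
and `b ≠ 0`. Hence nonzero pairs give words of nonzero weight, the parametrization is injective, and
counting codewords means counting pairs.

For fixed `a ≠ 0`, summing the sign sums over all `b` leaves only `x = t`, with total `2 ^ (2 * m)`.
This fixes the difference of the numbers of light and heavy words. Their sum is `|E|`, so both are
known, independently of `a` and `t`. -/

/-- The nontrivial additive character of `ZMod 2`, with integer values. -/
def binarySign (z : ZMod 2) : ℤ := (-1) ^ z.val

theorem binarySign_add (y z : ZMod 2) : binarySign (y + z) = binarySign y * binarySign z := by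
  revert y z; decide

theorem binarySign_eq_one_or (z : ZMod 2) : binarySign z = 1 ∨ binarySign z = -1 := by
  revert z; decide

theorem binarySign_eq_sub_ite (z : ZMod 2) : binarySign z = 1 - 2 * (if z ≠ 0 then 1 else 0) := by
  revert z; decide

/-- The sum of the signs of a binary word is its length minus twice its weight. -/
theorem sum_binarySign {ι : Type*} [Fintype ι] (w : ι → ZMod 2) :
    ∑ i, binarySign (w i) = (Fintype.card ι : ℤ) - 2 * (hammingNorm w : ℤ) := by
  simp only [binarySign_eq_sub_ite, Finset.sum_sub_distrib, ← Finset.mul_sum, Finset.sum_boole,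
    hammingNorm]
  simp

theorem exists_trace_mul_eq_one {E : Type*} [Field E] [Fintype E] [Algebra (ZMod 2) E] {b : E}
    (hb : b ≠ 0) : ∃ y, Algebra.trace (ZMod 2) E (b * y) = 1 := by
  obtain ⟨z, hz⟩ := Algebra.trace_surjective (ZMod 2) E 1
  exact ⟨b⁻¹ * z, by rw [mul_inv_cancel_left₀ hb, hz]⟩

/-- Translating `x` by some `y` with `Tr (b * y) = 1` flips every sign, so the sum equals its own
negative. -/
theorem sum_binarySign_trace_mul {E : Type*} [Field E] [Fintype E] [Algebra (ZMod 2) E] {b : E}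
    (hb : b ≠ 0) : ∑ x, binarySign (Algebra.trace (ZMod 2) E (b * x)) = 0 := by
  obtain ⟨y, hy⟩ := exists_trace_mul_eq_one hb
  have h := Equiv.sum_comp (Equiv.addRight y)
    (fun x => binarySign (Algebra.trace (ZMod 2) E (b * x)))
  have h1 : binarySign 1 = -1 := by decide
  simp only [Equiv.coe_addRight, mul_add, map_add, binarySign_add, hy, h1, ← Finset.sum_mul] at h
  linarith

theorem weightCount_range {k ι V : Type*} [Field k] [DecidableEq k] [Fintype ι]
    [AddCommGroup V] [Module k V] [Fintype V] (f : V →ₗ[k] (ι → k))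
    (hf : Function.Injective f) (w : ℕ) :
    weightCount (LinearMap.range f) w = (Finset.univ.filter fun v => hammingNorm (f v) = w).card := by
  rw [weightCount, ← Set.ncard_coe_finset, ← Set.ncard_image_of_injective _ hf]
  congr 1
  ext c
  simp only [LinearMap.mem_range, Set.mem_ofPred_eq, Finset.coe_filter, Finset.mem_univ, true_and,
    Set.mem_image]
  constructor
  · rintro ⟨⟨v, rfl⟩, h⟩
    exact ⟨v, h, rfl⟩
  · rintro ⟨v, h, rfl⟩
    exact ⟨⟨v, rfl⟩, h⟩

theorem hammingNorm_funLeft_subtype_val {k ι : Type*} [Field k] [DecidableEq k] [Fintype ι]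
    [DecidableEq ι] (T : Finset ι) (w : ι → k) (hw : ∀ i ∈ T, w i = 0) :
    hammingNorm (LinearMap.funLeft k k (Subtype.val : {i : ι // i ∉ T} → ι) w) =
      hammingNorm w := by
  simp only [hammingNorm, LinearMap.funLeft_apply]
  rw [← Finset.card_map (Function.Embedding.subtype _)]
  congr 1
  ext i
  simp only [Finset.mem_map, Finset.mem_filter, Finset.mem_univ, true_and,
    Function.Embedding.subtype_apply, Subtype.exists]
  constructor
  · rintro ⟨j, _, hj, rfl⟩
    exact (Finset.mem_filter.1 hj).2
  · intro hi
    exact ⟨i, fun hT => hi (hw i hT), Finset.mem_filter.2 ⟨Finset.mem_univ _, hi⟩, rfl⟩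

/-! ### Words vanishing at a given position -/

section

variable {E K : Type*} [Field E] [Algebra (ZMod 2) E] [Field K] [Algebra (ZMod 2) K]

/-- The word `(Tr (a * (F x - F t)) + Tr (b * (x - t)))_{x ∈ E}`, which vanishes at `t`. -/
noncomputable def basedWord (F : E → K) (t : E) : (K × E) →ₗ[ZMod 2] (E → ZMod 2) where
  toFun p x := Algebra.trace (ZMod 2) K (p.1 * (F x - F t)) +
    Algebra.trace (ZMod 2) E (p.2 * (x - t))
  map_add' p q := by
    ext x
    simp only [Prod.fst_add, Prod.snd_add, add_mul, map_add, Pi.add_apply]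
    ring
  map_smul' r p := by
    ext x
    simp only [Prod.smul_fst, Prod.smul_snd, smul_mul_assoc, map_smul, smul_eq_mul, Pi.smul_apply,
      RingHom.id_apply]
    ring

theorem basedWord_apply (F : E → K) (t : E) (p : K × E) (x : E) :
    basedWord F t p x = Algebra.trace (ZMod 2) K (p.1 * (F x - F t)) +
      Algebra.trace (ZMod 2) E (p.2 * (x - t)) := rfl

theorem basedWord_self (F : E → K) (t : E) (p : K × E) : basedWord F t p t = 0 := by
  simp [basedWord_apply]

/-- Vanishing at `t` forces `c = -Tr (a * F t) - Tr (b * t)`. -/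
theorem vanishingSubcode_vectorialCode (F : E → K) (t : E) :
    vanishingSubcode (vectorialCode F) {t} = LinearMap.range (basedWord F t) := by
  ext w
  constructor
  · rintro ⟨⟨a, b, c, h⟩, hw⟩
    refine ⟨(a, b), funext fun x => ?_⟩
    have ht := (h t).symm.trans (hw t (Finset.mem_singleton_self t))
    rw [h x, basedWord_apply]
    simp only [mul_sub, map_sub]
    linear_combination -ht
  · rintro ⟨p, rfl⟩
    refine ⟨⟨p.1, p.2, -Algebra.trace (ZMod 2) K (p.1 * F t) -
      Algebra.trace (ZMod 2) E (p.2 * t), fun x => ?_⟩, fun i hi => ?_⟩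
    · rw [basedWord_apply]
      simp only [mul_sub, map_sub]
      ring
    · rw [Finset.mem_singleton.1 hi, basedWord_self]

theorem shortenedCode_vectorialCode (F : E → K) (t : E) :
    shortenedCode (vectorialCode F) {t} =
      LinearMap.range (LinearMap.funLeft (ZMod 2) (ZMod 2)
        (Subtype.val : {i : E // i ∉ ({t} : Finset E)} → E) ∘ₗ basedWord F t) := by
  rw [shortenedCode, puncturedCode, vanishingSubcode_vectorialCode, LinearMap.range_comp]

/-! ### Sign sums and weights -/

variable [Fintype E]

theorem sum_binarySign_basedWord (F : E → K) (t : E) (p : K × E) :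
    ∑ x, binarySign (basedWord F t p x) = walsh F p.1 p.2 *
      binarySign (Algebra.trace (ZMod 2) K (p.1 * F t) + Algebra.trace (ZMod 2) E (p.2 * t)) := by
  rw [walsh, Finset.sum_mul]
  refine Finset.sum_congr rfl fun x _ => ?_
  change _ = binarySign _ * _
  rw [← binarySign_add, basedWord_apply]
  congr 1
  simp only [mul_sub, map_sub, CharTwo.sub_eq_add]
  ring

theorem IsBentVectorial.sum_binarySign_basedWord {m : ℕ} {F : E → K} (hF : IsBentVectorial m F)
    (t : E) {a : K} (ha : a ≠ 0) (b : E) :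
    ∑ x, binarySign (basedWord F t (a, b) x) = 2 ^ m ∨
      ∑ x, binarySign (basedWord F t (a, b) x) = -2 ^ m := by
  rw [_root_.sum_binarySign_basedWord]
  rcases hF a ha b with h | h <;>
    rcases binarySign_eq_one_or (Algebra.trace (ZMod 2) K (a * F t) +
      Algebra.trace (ZMod 2) E (b * t)) with h' | h' <;> simp [h, h']

theorem sum_binarySign_basedWord_zero_left (F : E → K) (t : E) {b : E} (hb : b ≠ 0) :
    ∑ x, binarySign (basedWord F t (0, b) x) = 0 := by
  simp only [basedWord_apply, zero_mul, map_zero, zero_add]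
  rw [← sum_binarySign_trace_mul hb]
  exact Equiv.sum_comp (Equiv.subRight t) fun x => binarySign (Algebra.trace (ZMod 2) E (b * x))

/-- After exchanging the sums, the inner sum over `b` is a nontrivial character sum unless `x = t`.
-/
theorem sum_sum_binarySign_basedWord (F : E → K) (t : E) (a : K) :
    ∑ b, ∑ x, binarySign (basedWord F t (a, b) x) = Fintype.card E := by
  rw [Finset.sum_comm, Finset.sum_eq_single t]
  · simp [basedWord_self, binarySign]
  · intro x _ hx
    simp only [basedWord_apply, binarySign_add, ← Finset.mul_sum]
    simp only [mul_comm _ (x - t)]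
    rw [sum_binarySign_trace_mul (sub_ne_zero.2 hx), mul_zero]
  · simp

variable {m : ℕ} {F : E → K}

theorem IsBentVectorial.hammingNorm_basedWord (hF : IsBentVectorial m F) (hm : 1 ≤ m)
    (hE : Fintype.card E = 2 ^ (2 * m)) (t : E) {a : K} (ha : a ≠ 0) (b : E) :
    (hammingNorm (basedWord F t (a, b)) = 2 ^ (2 * m - 1) - 2 ^ (m - 1) ∧
        ∑ x, binarySign (basedWord F t (a, b) x) = 2 ^ m) ∨
      (hammingNorm (basedWord F t (a, b)) = 2 ^ (2 * m - 1) + 2 ^ (m - 1) ∧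
        ∑ x, binarySign (basedWord F t (a, b) x) = -2 ^ m) := by
  have hs := _root_.sum_binarySign (basedWord F t (a, b))
  obtain ⟨n, rfl⟩ := Nat.exists_eq_add_of_le' hm
  have e1 : 2 * (n + 1) - 1 = 2 * n + 1 := by omega
  have e2 : 2 * (n + 1) = 2 * n + 1 + 1 := by ring
  have hle : 2 ^ n ≤ 2 ^ (2 * n + 1) := Nat.pow_le_pow_right (by norm_num) (by omega)
  rw [hE, e2] at hs
  rw [e1, Nat.add_sub_cancel]
  push_cast [pow_succ] at hs
  zify [hle]
  rcases hF.sum_binarySign_basedWord t ha b with h | h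
  · refine Or.inl ⟨?_, h⟩
    rw [h, pow_succ] at hs
    rw [pow_succ]
    linarith
  · refine Or.inr ⟨?_, h⟩
    rw [h, pow_succ] at hs
    rw [pow_succ]
    linarith

theorem hammingNorm_basedWord_zero_left (F : E → K) (hm : 1 ≤ m)
    (hE : Fintype.card E = 2 ^ (2 * m)) (t : E) {b : E} (hb : b ≠ 0) :
    hammingNorm (basedWord F t (0, b)) = 2 ^ (2 * m - 1) := by
  have hs := sum_binarySign (basedWord F t (0, b))
  rw [sum_binarySign_basedWord_zero_left F t hb, hE,
    show 2 * m = 2 * m - 1 + 1 by omega, pow_succ] at hs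
  push_cast at hs
  zify
  linarith

/-- For `a ≠ 0`, the numbers of light and of heavy words `basedWord F t (a, b)`. -/
theorem IsBentVectorial.card_filter_hammingNorm_basedWord (hF : IsBentVectorial m F) (hm : 1 ≤ m)
    (hE : Fintype.card E = 2 ^ (2 * m)) (t : E) {a : K} (ha : a ≠ 0) :
    (Finset.univ.filter fun b => hammingNorm (basedWord F t (a, b)) =
        2 ^ (2 * m - 1) - 2 ^ (m - 1)).card = 2 ^ (2 * m - 1) + 2 ^ (m - 1) ∧
      (Finset.univ.filter fun b => hammingNorm (basedWord F t (a, b)) =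
        2 ^ (2 * m - 1) + 2 ^ (m - 1)).card = 2 ^ (2 * m - 1) - 2 ^ (m - 1) := by
  -- Positivity separates the light weight from the heavy one.
  have hp : 0 < 2 ^ (m - 1) := by positivity
  have hle : 2 ^ (m - 1) ≤ 2 ^ (2 * m - 1) := Nat.pow_le_pow_right (by norm_num) (by omega)
  have hcompl : (Finset.univ.filter fun b => hammingNorm (basedWord F t (a, b)) =
      2 ^ (2 * m - 1) + 2 ^ (m - 1)) = Finset.univ.filter fun b =>
        ¬ hammingNorm (basedWord F t (a, b)) = 2 ^ (2 * m - 1) - 2 ^ (m - 1) := by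
    refine Finset.filter_congr fun b _ => ?_
    rcases hF.hammingNorm_basedWord hm hE t ha b with h | h <;> rw [h.1] <;> omega
  have hcard := Finset.card_filter_add_card_filter_not (s := (Finset.univ : Finset E))
    (fun b => hammingNorm (basedWord F t (a, b)) = 2 ^ (2 * m - 1) - 2 ^ (m - 1))
  have hsum := sum_sum_binarySign_basedWord F t a
  have hval : ∀ b : E, ∑ x, binarySign (basedWord F t (a, b) x) =
      if hammingNorm (basedWord F t (a, b)) = 2 ^ (2 * m - 1) - 2 ^ (m - 1)
        then 2 ^ m else -2 ^ m := by
    intro b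
    rcases hF.hammingNorm_basedWord hm hE t ha b with h | h
    · rw [if_pos h.1, h.2]
    · rw [if_neg (by omega), h.2]
  simp only [hval, Finset.sum_ite, Finset.sum_const, nsmul_eq_mul] at hsum
  rw [hcompl]
  rw [Finset.card_univ, hE] at hcard
  rw [hE] at hsum
  generalize (Finset.univ.filter fun b => hammingNorm (basedWord F t (a, b)) =
      2 ^ (2 * m - 1) - 2 ^ (m - 1)).card = A at *
  generalize (Finset.univ.filter fun b => ¬ hammingNorm (basedWord F t (a, b)) =
      2 ^ (2 * m - 1) - 2 ^ (m - 1)).card = B at *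
  -- The sign sums total `A * 2 ^ m - B * 2 ^ m = 2 ^ (2 * m)`; cancel `2 ^ m`.
  have hdiff : (A : ℤ) - B = 2 ^ m := by
    have h2 : (2 : ℤ) ^ m ≠ 0 := by positivity
    apply mul_right_cancel₀ h2
    push_cast at hsum
    rw [← pow_add, ← two_mul]
    linarith
  have e1 : 2 ^ (2 * m) = 2 * 2 ^ (2 * m - 1) := by rw [← pow_succ']; congr 1; omega
  have e2 : (2 : ℤ) ^ m = 2 * (2 ^ (m - 1) : ℕ) := by
    push_cast; rw [← pow_succ']; congr 1; omega
  rw [e1] at hcard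
  rw [e2] at hdiff
  omega

theorem card_filter_prod_eq_sum {α β : Type*} [Fintype α] [Fintype β] (P : α × β → Prop)
    [DecidablePred P] :
    (Finset.univ.filter P).card = ∑ a, (Finset.univ.filter fun b => P (a, b)).card := by
  simp only [Finset.card_filter]
  exact Fintype.sum_prod_type _

/-- If no word `basedWord F t (0, b)` has weight `w` and, for each `a ≠ 0`, exactly `N` words
`basedWord F t (a, b)` do, then `(|K| - 1) * N` words do. -/
theorem card_filter_hammingNorm_basedWord_eq_mul [Fintype K] (F : E → K) (t : E) (w N : ℕ)
    (h0 : ∀ b, hammingNorm (basedWord F t (0, b)) ≠ w)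
    (h : ∀ a : K, a ≠ 0 →
      (Finset.univ.filter fun b => hammingNorm (basedWord F t (a, b)) = w).card = N) :
    (Finset.univ.filter fun p => hammingNorm (basedWord F t p) = w).card =
      (Fintype.card K - 1) * N := by
  classical
  rw [card_filter_prod_eq_sum, ← Finset.add_sum_erase _ _ (Finset.mem_univ 0),
    Finset.sum_congr rfl fun a ha => h a (Finset.ne_of_mem_erase ha)]
  simp [h0, Finset.card_erase_of_mem]

end

theorem mainTheorem11 {E K : Type*}
    [Field E] [Fintype E] [DecidableEq E] [Algebra (ZMod 2) E]
    [Field K] [Fintype K] [Algebra (ZMod 2) K]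
    (m l : ℕ) (hm : 3 ≤ m)
    (hE : Fintype.card E = 2 ^ (2 * m)) (hK : Fintype.card K = 2 ^ l)
    (F : E → K) (hF : IsBentVectorial m F) (t₁ : E) :
    codeLength (shortenedCode (vectorialCode F) {t₁}) = 2 ^ (2 * m) - 1 ∧
    Module.finrank (ZMod 2) (shortenedCode (vectorialCode F) {t₁}) = 2 * m + l ∧
    weightCount (shortenedCode (vectorialCode F) {t₁}) 0 = 1 ∧
    weightCount (shortenedCode (vectorialCode F) {t₁}) (2 ^ (2 * m - 1) - 2 ^ (m - 1)) =
      (2 ^ l - 1) * (2 ^ (2 * m - 1) + 2 ^ (m - 1)) ∧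
    weightCount (shortenedCode (vectorialCode F) {t₁}) (2 ^ (2 * m - 1)) = 2 ^ (2 * m) - 1 ∧
    weightCount (shortenedCode (vectorialCode F) {t₁}) (2 ^ (2 * m - 1) + 2 ^ (m - 1)) =
      (2 ^ l - 1) * (2 ^ (2 * m - 1) - 2 ^ (m - 1)) ∧
    ∀ w : ℕ, w ≠ 0 → w ≠ 2 ^ (2 * m - 1) - 2 ^ (m - 1) → w ≠ 2 ^ (2 * m - 1) →
      w ≠ 2 ^ (2 * m - 1) + 2 ^ (m - 1) →
      weightCount (shortenedCode (vectorialCode F) {t₁}) w = 0 := by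
  classical
  have hm1 : 1 ≤ m := by omega
  have hp : 0 < 2 ^ (m - 1) := by positivity
  -- Strictness makes the light weight nonzero, which injectivity needs.
  have hlt : 2 ^ (m - 1) < 2 ^ (2 * m - 1) := Nat.pow_lt_pow_right (by norm_num) (by omega)
  have hnorm : ∀ p, hammingNorm ((LinearMap.funLeft (ZMod 2) (ZMod 2)
      (Subtype.val : {i : E // i ∉ ({t₁} : Finset E)} → E) ∘ₗ basedWord F t₁) p) =
        hammingNorm (basedWord F t₁ p) := fun p =>
    hammingNorm_funLeft_subtype_val {t₁} (basedWord F t₁ p) fun i hi => by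
      rw [Finset.mem_singleton.1 hi, basedWord_self]
  have h00 : hammingNorm (basedWord F t₁ (0, 0)) = 0 := by
    rw [← Prod.zero_eq_mk, map_zero, hammingNorm_zero]
  have hzero : ∀ p, hammingNorm (basedWord F t₁ p) = 0 ↔ p = 0 := by
    rintro ⟨a, b⟩
    refine ⟨fun h => ?_, fun h => by rw [h]; exact h00⟩
    by_cases ha : a = 0
    · subst ha
      by_contra hb
      rw [hammingNorm_basedWord_zero_left F hm1 hE t₁ fun hb' => hb (by rw [hb']; rfl)] at h
      omega
    · rcases hF.hammingNorm_basedWord hm1 hE t₁ ha b with h' | h' <;> omega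
  have hinj : Function.Injective (LinearMap.funLeft (ZMod 2) (ZMod 2)
      (Subtype.val : {i : E // i ∉ ({t₁} : Finset E)} → E) ∘ₗ basedWord F t₁) := by
    rw [injective_iff_map_eq_zero]
    intro p hpz
    rw [← hzero, ← hnorm, hpz, hammingNorm_zero]
  have hcount : ∀ w, weightCount (shortenedCode (vectorialCode F) {t₁}) w =
      (Finset.univ.filter fun p => hammingNorm (basedWord F t₁ p) = w).card := by
    intro w
    simp only [shortenedCode_vectorialCode, weightCount_range _ hinj, hnorm]
  have h0 : ∀ b, hammingNorm (basedWord F t₁ (0, b)) = 0 ∨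
      hammingNorm (basedWord F t₁ (0, b)) = 2 ^ (2 * m - 1) := by
    intro b
    by_cases hb : b = 0
    · subst hb
      exact Or.inl h00
    · exact Or.inr (hammingNorm_basedWord_zero_left F hm1 hE t₁ hb)
  refine ⟨?_, ?_, ?_, ?_, ?_, ?_, ?_⟩
  · rw [codeLength, Fintype.card_subtype_compl, hE]
    simp
  · rw [shortenedCode_vectorialCode, LinearMap.finrank_range_of_inj hinj]
    -- Compare `2 ^ dim` with the cardinality of `K × E`.
    apply Nat.pow_right_injective le_rfl
    have h := Module.card_eq_pow_finrank (K := ZMod 2) (V := K × E)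
    rw [ZMod.card, Fintype.card_prod, hE, hK] at h
    simp only
    rw [← h, pow_add, mul_comm]
  · rw [hcount, Finset.card_eq_one]
    exact ⟨0, by ext p; simp [hzero]⟩
  · rw [hcount, ← hK]
    refine card_filter_hammingNorm_basedWord_eq_mul F t₁ _ _ (fun b => ?_) fun a ha =>
      (hF.card_filter_hammingNorm_basedWord hm1 hE t₁ ha).1
    rcases h0 b with h | h <;> omega
  · rw [hcount, card_filter_prod_eq_sum, Finset.sum_eq_single 0]
    · rw [← hE, ← Finset.card_univ, ← Finset.card_erase_of_mem (Finset.mem_univ 0)]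
      congr 1
      ext b
      by_cases hb : b = 0
      · subst hb
        simp [h00, (hp.trans hlt).ne]
      · simp [hb, hammingNorm_basedWord_zero_left F hm1 hE t₁ hb]
    · intro a _ ha
      rw [Finset.card_eq_zero, Finset.filter_eq_empty_iff]
      intro b _
      rcases hF.hammingNorm_basedWord hm1 hE t₁ ha b with h | h <;> omega
    · simp
  · rw [hcount, ← hK]
    refine card_filter_hammingNorm_basedWord_eq_mul F t₁ _ _ (fun b => ?_) fun a ha =>
      (hF.card_filter_hammingNorm_basedWord hm1 hE t₁ ha).2
    rcases h0 b with h | h <;> omega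
  · intro w hw0 hw1 hw2 hw3
    rw [hcount, Finset.card_eq_zero, Finset.filter_eq_empty_iff]
    rintro ⟨a, b⟩ _
    by_cases ha : a = 0
    · subst ha
      rcases h0 b with h | h <;> omega
    · rcases hF.hammingNorm_basedWord hm1 hE t₁ ha b with h | h <;> omega
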